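/- All rings are commutative with unit. For a ring $A$, a regular element is a non-zero-divisor, $\mathrm{Reg}(A)$ is the set of regular elements, and $K$ is the total quotient ring of $A$. An ideal is regular if it contains a regular element, and a minimal regular prime is a minimal element of the set of regular prime ideals. An overring of $A$ is a ring $B$ with $A\subseteq B\subseteq K$; it is unibranched if the contraction map $\mathrm{Spec}(B)\to\mathrm{Spec}(A)$ is bijective. The ring $A$ is perinormal if every overring $B$ of $A$ such that $A\subseteq B$ satisfies going down is flat as an $A$-module. For a prime ideal $P$ of $A$, the regular quotient ring $A_{(P)}\subseteq K$ is the fraction ring of $A$ with denominators in $(A\setminus P)\cap \mathrm{Reg}(A)$; its total quotient ring is again $K$. A subring $V$ of $K$ is a (Manis) discrete valuation ring (DVR) on $K$ if $V=\{x\in K\mid v(x)\ge 0\}$ for some surjective map $v:K\to\mathbb{Z}\cup\{\infty\}$ with $v(xy)=v(x)+v(y)$, $v(x+y)\ge\min\{v(x),v(y)\}$ for all $x,y\in K$, $v(1)=0$ and $v(0)=\infty$. **Theorem.** Let $A$ be a Noetherian ring with total quotient ring $K$, and let $A'$ be the integral closure of $A$ in $K$. Assume that $A_{(P\cap A)}$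 is a DVR on $K$ for every minimal regular prime $P$ of $A'$. Then the following are equivalent. (a) $A$ is perinormal. (b) Whenever $P$ is a prime ideal of $A$ and $B$ is an integral unibranched overring of $A_{(P)}$, we have $A_{(P)}=B$. -/

import Mathlib

open scoped nonZeroDivisors WithZero

/-- An ideal is regular if it contains a regular element (a non-zero-divisor). -/
def IsRegularIdeal {R : Type*} [CommRing R] (I : Ideal R) : Prop :=
  ∃ x ∈ I, x ∈ R⁰

/-- A minimal regular prime: a minimal element of the set of regular prime ideals. -/
def IsMinimalRegularPrime {R : Type*} [CommRing R] (P : Ideal R) : Prop :=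
  Minimal (fun Q : Ideal R => Q.IsPrime ∧ IsRegularIdeal Q) P

/-- The regular quotient ring `A_(P)`: the fraction ring of `A` with denominators the regular
elements of `A` outside `P`, as a subring of the total quotient ring `K` of `A`. -/
noncomputable def regularQuotient {A : Type*} [CommRing A] (K : Type*) [CommRing K] [Algebra A K]
    [IsFractionRing A K] (P : Ideal A) [P.IsPrime] : Subalgebra A K :=
  Localization.subalgebra K (P.primeCompl ⊓ A⁰) inf_le_right

/-- A subring `V` of `K` is a (rank one) discrete Manis valuation ring on `K` if it is the ring of
a surjective valuation `K → ℤ ∪ {∞}` (written multiplicatively, with reversed order). -/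
def IsManisDVR {K : Type*} [CommRing K] (V : Subring K) : Prop :=
  ∃ v : Valuation K ℤᵐ⁰, Function.Surjective v ∧ v.integer = V

/-- `A`, with total quotient ring `K`, is perinormal if every overring `B` of `A` (a ring between
`A` and `K`) such that `A ⊆ B` satisfies going down is flat over `A`. -/
def IsPerinormal (A K : Type*) [CommRing A] [CommRing K] [Algebra A K] [IsFractionRing A K] :
    Prop :=
  ∀ B : Subalgebra A K, Algebra.HasGoingDown A B → Module.Flat A B

/-- `A ⊆ B` is unibranched if the contraction map `Spec B → Spec A` is bijective. -/
def IsUnibranched (A B : Type*) [CommRing A] [CommRing B] [Algebra A B] : Prop :=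
  Function.Bijective (PrimeSpectrum.comap (algebraMap A B))

/-! (a) ⇒ (b): an integral unibranched overring `B` of `A_(P)` has going down over `A`, hence is
flat over `A` and over `A_(P)`. Being surjective on spectra it is faithfully flat, and a faithfully
flat overring is trivial.

(b) ⇒ (a): let `B` have going down, `Q` be maximal in `B`, `P = Q ∩ A`, `R = A_(P)`, and let `C` be
`B` localized at the regular elements of `A` outside `P`. Regular primes of `R` lie below `P`, so
going down lifts them, and chains of two, to `C`. With `R'` the integral closure, `D = C ∩ R'` is
unibranched over `R` (`isUnibranched_inf_integralClosure`): two primes of `D` over one regular prime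
would be separated by a height-one prime of a Noetherian `R[c]`, and there `R` already agrees with
`R'` because of the DVR hypothesis. By (b), `D = R`. An associated prime of `C/R` would then produce
an integral element of `C` outside `R`, so `C = R` (`eq_bot_of_inf_integralClosure_eq_bot`). Thus `A
→ B` is locally surjective at each `Q`, which gives flatness. -/

theorem mem_nonZeroDivisors_of_isUnit_coe {A K : Type*} [CommRing A] [CommRing K] [Algebra A K]
    (T : Subalgebra A K) {x : T} (hx : IsUnit (x : K)) :
    x ∈ T⁰ := by
  rw [mem_nonZeroDivisors_iff_right]
  intro c hc
  have : (c : K) * x = 0 := congrArg Subtype.val hc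
  exact Subtype.ext ((hx.mul_left_eq_zero).1 this)

/-! ### Regular elements and regular ideals in overrings. -/

section Overring

variable {A K : Type*} [CommRing A] [CommRing K] [Algebra A K] [IsFractionRing A K]

theorem isUnit_coe_of_mem_nonZeroDivisors (T : Subalgebra A K) {x : T} (hx : x ∈ T⁰) :
    IsUnit (x : K) := by
  obtain ⟨⟨a, s⟩, has⟩ := IsLocalization.surj A⁰ (x : K)
  have hs : IsUnit (algebraMap A K s) := IsLocalization.map_units K s
  have ha : a ∈ A⁰ := by
    rw [mem_nonZeroDivisors_iff_right]
    intro c hc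
    have h : (x : K) * algebraMap A K c = 0 := by
      rw [← hs.mul_left_inj, zero_mul, mul_right_comm, has, ← map_mul, mul_comm, hc, map_zero]
    have h' : algebraMap A T c * x = 0 := Subtype.ext (by simpa [mul_comm] using h)
    have := congrArg Subtype.val ((mem_nonZeroDivisors_iff_right.1 hx) _ h')
    exact (IsFractionRing.injective A K) (by simpa using this)
  have hau : IsUnit (algebraMap A K a) := IsLocalization.map_units K (⟨a, ha⟩ : A⁰)
  exact isUnit_of_mul_isUnit_left (has ▸ hau)

theorem algebraMap_mem_nonZeroDivisors (T : Subalgebra A K) {a : A} (ha : a ∈ A⁰) :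
    algebraMap A T a ∈ T⁰ :=
  mem_nonZeroDivisors_of_isUnit_coe T (IsLocalization.map_units K (⟨a, ha⟩ : A⁰))

theorem inclusion_mem_nonZeroDivisors {T T' : Subalgebra A K} (h : T ≤ T') {x : T} (hx : x ∈ T⁰) :
    Subalgebra.inclusion h x ∈ T'⁰ :=
  mem_nonZeroDivisors_of_isUnit_coe T' (isUnit_coe_of_mem_nonZeroDivisors T hx)

theorem IsRegularIdeal.comap_algebraMap (T : Subalgebra A K) {I : Ideal T}
    (hI : IsRegularIdeal I) : IsRegularIdeal (I.comap (algebraMap A T)) := by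
  obtain ⟨x, hxI, hx⟩ := hI
  obtain ⟨⟨a, s⟩, has⟩ := IsLocalization.surj A⁰ (x : K)
  have h : x * algebraMap A T s = algebraMap A T a := Subtype.ext has
  refine ⟨a, ?_, ?_⟩
  · rw [Ideal.mem_comap, ← h]
    exact I.mul_mem_right _ hxI
  · rw [mem_nonZeroDivisors_iff_right]
    intro c hc
    have h1 : algebraMap A T c * (x * algebraMap A T s) = 0 := by
      rw [h, ← map_mul, hc, map_zero]
    have h2 := (mem_nonZeroDivisors_iff_right.1
      (mul_mem hx (algebraMap_mem_nonZeroDivisors T s.2))) _ h1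
    exact (IsFractionRing.injective A K) (by simpa using congrArg Subtype.val h2)

theorem IsRegularIdeal.of_comap_algebraMap (T : Subalgebra A K) {I : Ideal T}
    (hI : IsRegularIdeal (I.comap (algebraMap A T))) : IsRegularIdeal I := by
  obtain ⟨x, hxI, hx⟩ := hI
  exact ⟨_, hxI, algebraMap_mem_nonZeroDivisors T hx⟩

end Overring

/-- Prime avoidance for regular ideals of a Noetherian ring. -/
theorem IsRegularIdeal.exists_regular_notMem {R : Type*} [CommRing R] [IsNoetherianRing R]
    {I P : Ideal R} [P.IsPrime] (hI : IsRegularIdeal I) (hIP : ¬ I ≤ P) :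
    ∃ x ∈ I, x ∈ R⁰ ∧ x ∉ P := by
  by_contra! h
  -- The associated primes cover the zero-divisors and are finite in number, so prime avoidance
  -- applies to them together with `P`.
  have hsub : (I : Set R) ⊆ ⋃ J ∈ insert P (associatedPrimes R R), ((id J : Ideal R) : Set R) := by
    intro x hx
    rw [Set.biUnion_insert]
    by_cases hxR : x ∈ R⁰
    · exact Or.inl (h x hx hxR)
    · right
      simp_rw [id, biUnion_associatedPrimes_eq_compl_nonZeroDivisors]
      exact hxR
  obtain ⟨J, hJ, hIJ⟩ := (I.subset_union_prime_finite ((associatedPrimes.finite R R).insert P)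
    P P (by
      rintro i (rfl | hi) h1 _
      · exact absurd rfl h1
      · exact hi.1)).1 hsub
  rcases hJ with rfl | hJ
  · exact hIP hIJ
  · obtain ⟨x, hxI, hx⟩ := hI
    have : x ∈ ⋃ J ∈ associatedPrimes R R, (J : Set R) := Set.mem_biUnion hJ (hIJ hxI)
    rw [biUnion_associatedPrimes_eq_compl_nonZeroDivisors] at this
    exact this hx

/-- Clears a denominator `s` lying outside `J`; this is how primes of an overring are compared
through their contractions. -/
theorem Ideal.mem_of_comap_algebraMap_eq {R D : Type*} [CommRing R] [CommRing D] [Algebra R D]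
    {I J : Ideal D} [J.IsPrime] (h : I.comap (algebraMap R D) ≤ J.comap (algebraMap R D))
    {x : D} (hx : x ∈ I) {s a : R} (hs : s ∉ J.comap (algebraMap R D))
    (hsx : algebraMap R D s * x = algebraMap R D a) : x ∈ J := by
  have ha : a ∈ I.comap (algebraMap R D) := by
    rw [Ideal.mem_comap, ← hsx]
    exact I.mul_mem_left _ hx
  have := h ha
  rw [Ideal.mem_comap, ← hsx] at this
  exact (Ideal.IsPrime.mem_or_mem ‹_› this).resolve_left hs

/-! ### Primes under localization, for maps presented by denominators. -/

section Localization

variable {T T' : Type*} [CommRing T] [CommRing T'] (f : T →+* T') (S : Submonoid T)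

theorem RingHom.le_of_comap_le_of_localization
    (hu : ∀ s ∈ S, IsUnit (f s)) (hs : ∀ x : T', ∃ s ∈ S, ∃ t, f s * x = f t)
    {I J : Ideal T'} (h : I.comap f ≤ J.comap f) : I ≤ J := by
  intro x hx
  obtain ⟨s, hsS, t, hst⟩ := hs x
  have ht : t ∈ I.comap f := by
    rw [Ideal.mem_comap, ← hst]
    exact I.mul_mem_left _ hx
  have := h ht
  rw [Ideal.mem_comap, ← hst] at this
  exact (J.unit_mul_mem_iff_mem (hu s hsS)).1 this

theorem RingHom.exists_prime_comap_eq_of_localization (hf : Function.Injective f)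
    (hu : ∀ s ∈ S, IsUnit (f s)) (hs : ∀ x : T', ∃ s ∈ S, ∃ t, f s * x = f t)
    (q : Ideal T) (hq : q.IsPrime) (hqS : Disjoint (S : Set T) q) :
    ∃ q' : Ideal T', q'.IsPrime ∧ q'.comap f = q := by
  algebraize [f]
  have : IsLocalization S T' :=
    { map_units := fun s => hu s s.2
      surj := fun x => by
        obtain ⟨s, hsS, t, hst⟩ := hs x
        exact ⟨(t, ⟨s, hsS⟩), by rw [mul_comm]; exact hst⟩
      exists_of_eq := fun {x y} h => ⟨1, by rw [hf h]⟩ }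
  exact ⟨q.map f, IsLocalization.isPrime_of_isPrime_disjoint S T' q hq hqS,
    IsLocalization.under_map_of_isPrime_disjoint S T' hq hqS⟩

end Localization

/-! ### Minimal regular primes of the integral closure. -/

section MinimalRegularPrime

variable {R K : Type*} [CommRing R] [CommRing K] [Algebra R K]
  [IsFractionRing R K]

/-- A prime minimal over a regular principal ideal of a Noetherian integral overring is the
contraction of a minimal regular prime of the integral closure. -/
theorem exists_isMinimalRegularPrime_comap_eq (T : Subalgebra R K) [IsNoetherianRing T]
    (hT : T ≤ integralClosure R K) {b : T} (hb : b ∈ T⁰) {n : Ideal T}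
    (hn : n ∈ (Ideal.span {b}).minimalPrimes) :
    ∃ N : Ideal (integralClosure R K), N.IsPrime ∧ IsMinimalRegularPrime N ∧
      N.comap (Subalgebra.inclusion hT).toRingHom = n := by
  set f := (Subalgebra.inclusion hT).toRingHom with hf
  have hnp : n.IsPrime := hn.1.1
  have hbn : b ∈ n := hn.1.2 (Ideal.mem_span_singleton_self b)
  let : Algebra T (integralClosure R K) := f.toAlgebra
  have : IsScalarTower R T (integralClosure R K) := IsScalarTower.of_algebraMap_eq fun _ => rfl
  have : Algebra.IsIntegral T (integralClosure R K) := Algebra.IsIntegral.tower_top R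
  have hinj : Function.Injective f := Subalgebra.inclusion_injective hT
  obtain ⟨N, -, hN, hNn⟩ := Ideal.exists_ideal_over_prime_of_isIntegral (S := integralClosure R K)
    n ⊥ (by
      rw [Ideal.comap_bot_of_injective (algebraMap T (integralClosure R K)) hinj]; exact bot_le)
  refine ⟨N, hN, ⟨⟨hN, f b, ?_, inclusion_mem_nonZeroDivisors hT hb⟩, ?_⟩, hNn⟩
  · have : b ∈ N.comap f := by rw [show N.comap f = n from hNn]; exact hbn
    exact this
  · rintro N' ⟨hN', hreg⟩ hle
    -- By incomparability a smaller regular prime contracts strictly below `n`. Krull's principal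
    -- ideal theorem makes that contraction a minimal prime, which contains no regular element.
    by_contra hcon
    have hlt := Ideal.IsIntegral.comap_lt_comap (R := T) (lt_of_le_not_ge hle hcon)
    rw [hNn] at hlt
    set n' := N'.comap (algebraMap T (integralClosure R K)) with hn'
    have hn'p : n'.IsPrime := Ideal.comap_isPrime _ _
    have hn'reg : ∃ c ∈ n', c ∈ T⁰ := by
      obtain ⟨c, hc, hc0⟩ := IsRegularIdeal.comap_algebraMap _ hreg
      exact ⟨algebraMap R T c, hc, algebraMap_mem_nonZeroDivisors T hc0⟩
    have hheight := Ideal.height_le_one_of_isPrincipal_of_mem_minimalPrimes _ n hn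
    have hle1 : n'.height + 1 ≤ 0 + 1 := by
      simpa using (Ideal.height_add_one_le_of_lt_of_isPrime hlt).trans hheight
    have h0 : n'.height = 0 := by
      simpa using (ENat.add_le_add_iff_right ENat.one_ne_top).1 hle1
    rw [Ideal.height_eq_zero_iff] at h0
    obtain ⟨c, hc, hc0⟩ := hn'reg
    exact Set.disjoint_left.1 (Ideal.disjoint_nonZeroDivisors_of_mem_minimalPrimes h0) hc hc0

end MinimalRegularPrime

/-! ### The integral part of an overring: unibranchedness and triviality. -/

section Unibranched

variable {R K : Type*} [CommRing R] [IsNoetherianRing R] [CommRing K] [Algebra R K]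
  [IsFractionRing R K]

/-- A regular `b` in `q'` but not in `q` lies in some prime `n` minimal over it. By `hN`, `b` is a
fraction over `R` with denominator outside `n ∩ R`, so every prime of `D` over `n ∩ R` contains `b`.
By `hgd` one of these lies below `q`, a contradiction. -/
theorem Ideal.eq_of_comap_eq_of_generalizing (D : Subalgebra R K) (hD : D ≤ integralClosure R K)
    (hN : ∀ N : Ideal (integralClosure R K), N.IsPrime → IsMinimalRegularPrime N →
      ∀ x ∈ integralClosure R K, ∃ s, s ∉ N.comap (algebraMap R (integralClosure R K)) ∧
        ∃ a, algebraMap R K s * x = algebraMap R K a)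
    {q q' : Ideal D} [q.IsPrime] [q'.IsPrime]
    (hq : IsRegularIdeal (q.comap (algebraMap R D)))
    (hgd : ∀ p : Ideal R, p.IsPrime → IsRegularIdeal p → p ≤ q.comap (algebraMap R D) →
      ∃ q₀ ≤ q, q₀.IsPrime ∧ q₀.comap (algebraMap R D) = p)
    (hqq' : q'.comap (algebraMap R D) = q.comap (algebraMap R D)) : q' = q := by
  have : Algebra.IsIntegral R D := ⟨fun x =>
    (isIntegral_algHom_iff D.val Subtype.val_injective).1 (hD x.2)⟩
  suffices hle : q' ≤ q by
    by_contra hne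
    exact (Ideal.IsIntegral.comap_lt_comap (R := R) (lt_of_le_of_ne hle hne)).ne hqq'
  by_contra hle
  obtain ⟨c, hcq', hcq⟩ := SetLike.not_le_iff_exists.1 hle
  set T : Subalgebra R K := Algebra.adjoin R {(c : K)} with hTdef
  have hTD : T ≤ D := Algebra.adjoin_le (by simp)
  have hT : T ≤ integralClosure R K := hTD.trans hD
  have hTn : IsNoetherianRing T := isNoetherianRing_of_fg ⟨{(c : K)}, by simp [hTdef]⟩
  set f := (Subalgebra.inclusion hTD).toRingHom with hf
  have hfR : f.comp (algebraMap R T) = algebraMap R D := rfl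
  have hreg : IsRegularIdeal (q'.comap f) := by
    apply IsRegularIdeal.of_comap_algebraMap T
    rw [Ideal.comap_comap, hfR, hqq']
    exact hq
  have hnle : ¬ q'.comap f ≤ q.comap f := fun h =>
    hcq (h (show (⟨c, Algebra.subset_adjoin rfl⟩ : T) ∈ q'.comap f from hcq'))
  obtain ⟨b, hbq', hb, hbq⟩ := hreg.exists_regular_notMem hnle
  obtain ⟨n, hn, hnq'⟩ := Ideal.exists_minimalPrimes_le
    ((Ideal.span_singleton_le_iff_mem _).2 hbq')
  have hbn : b ∈ n := hn.1.2 (Ideal.mem_span_singleton_self b)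
  have hnp : n.IsPrime := hn.1.1
  obtain ⟨N, hNp, hNmin, hNn⟩ := exists_isMinimalRegularPrime_comap_eq T hT hb hn
  have hNR : N.comap (algebraMap R (integralClosure R K)) = n.comap (algebraMap R T) := by
    rw [← hNn, Ideal.comap_comap]; rfl
  have hnreg : IsRegularIdeal (n.comap (algebraMap R T)) :=
    IsRegularIdeal.comap_algebraMap T ⟨b, hbn, hb⟩
  have hnle : n.comap (algebraMap R T) ≤ q.comap (algebraMap R D) := by
    rw [← hqq', ← hfR, ← Ideal.comap_comap]
    exact Ideal.comap_mono hnq'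
  obtain ⟨q₀, hq₀q, hq₀, hq₀n⟩ := hgd _ inferInstance hnreg hnle
  obtain ⟨s, hs, a, hsa⟩ := hN N hNp hNmin b (hT b.2)
  have hq₀T : (q₀.comap f).comap (algebraMap R T) = n.comap (algebraMap R T) := by
    rw [Ideal.comap_comap, hfR, hq₀n]
  have hbq₀ : b ∈ q₀.comap f := Ideal.mem_of_comap_algebraMap_eq (R := R) hq₀T.ge hbn
    (by rwa [hq₀T, ← hNR]) (Subtype.ext hsa)
  exact hbq (hq₀q hbq₀)

theorem isUnibranched_inf_integralClosure (C : Subalgebra R K)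
    (hC : ∀ p : Ideal R, p.IsPrime → IsRegularIdeal p → ∃ q : Ideal C, q.IsPrime ∧
      q.comap (algebraMap R C) = p ∧ ∀ p₀ : Ideal R, p₀.IsPrime → IsRegularIdeal p₀ → p₀ ≤ p →
        ∃ q₀ ≤ q, q₀.IsPrime ∧ q₀.comap (algebraMap R C) = p₀)
    (hN : ∀ N : Ideal (integralClosure R K), N.IsPrime → IsMinimalRegularPrime N →
      ∀ x ∈ integralClosure R K, ∃ s, s ∉ N.comap (algebraMap R (integralClosure R K)) ∧
        ∃ a, algebraMap R K s * x = algebraMap R K a) :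
    Algebra.IsIntegral R (C ⊓ integralClosure R K : Subalgebra R K) ∧
    IsUnibranched R (C ⊓ integralClosure R K : Subalgebra R K) := by
  set D : Subalgebra R K := C ⊓ integralClosure R K with hDdef
  have hint : Algebra.IsIntegral R D := ⟨fun x =>
    (isIntegral_algHom_iff D.val Subtype.val_injective).1 x.2.2⟩
  have hinj : Function.Injective (algebraMap R D) := fun x y h =>
    IsFractionRing.injective R K (congrArg Subtype.val h)
  have : FaithfulSMul R D := (faithfulSMul_iff_algebraMap_injective R D).2 hinj
  refine ⟨hint, ?_, Algebra.IsIntegral.comap_surjective R D⟩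
  intro Q₁ Q₂ h
  have h' : Q₁.asIdeal.comap (algebraMap R D) = Q₂.asIdeal.comap (algebraMap R D) :=
    congrArg PrimeSpectrum.asIdeal h
  by_cases hreg : IsRegularIdeal (Q₁.asIdeal.comap (algebraMap R D))
  · obtain ⟨q, hq, hqp, hgd⟩ := hC _ inferInstance hreg
    set f := (Subalgebra.inclusion (inf_le_left : D ≤ C)).toRingHom
    have hfR : f.comp (algebraMap R D) = algebraMap R C := rfl
    have hqf : (q.comap f).comap (algebraMap R D) = Q₁.asIdeal.comap (algebraMap R D) := by
      rw [Ideal.comap_comap, hfR, hqp]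
    have key : ∀ Q : Ideal D, Q.IsPrime →
        Q.comap (algebraMap R D) = Q₁.asIdeal.comap (algebraMap R D) → Q = q.comap f := by
      intro Q hQ hQ₁
      refine Ideal.eq_of_comap_eq_of_generalizing D inf_le_right hN (by rwa [hqf]) ?_
        (hQ₁.trans hqf.symm)
      intro p hp hpreg hpq
      obtain ⟨q₀, hq₀q, hq₀, hq₀p⟩ := hgd p hp hpreg (hpq.trans hqf.le)
      exact ⟨q₀.comap f, Ideal.comap_mono hq₀q, inferInstance, by
        rw [Ideal.comap_comap, hfR, hq₀p]⟩
    exact PrimeSpectrum.ext ((key _ Q₁.2 rfl).trans (key _ Q₂.2 h'.symm).symm)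
  -- Over a non-regular prime every regular denominator is harmless, so the contraction determines
  -- the prime.
  · have key : ∀ Q Q' : PrimeSpectrum D,
        Q.asIdeal.comap (algebraMap R D) = Q'.asIdeal.comap (algebraMap R D) →
        ¬ IsRegularIdeal (Q'.asIdeal.comap (algebraMap R D)) → Q.asIdeal ≤ Q'.asIdeal := by
      intro Q Q' hQQ' hnr x hx
      obtain ⟨⟨a, s⟩, has⟩ := IsLocalization.surj R⁰ (x : K)
      exact Ideal.mem_of_comap_algebraMap_eq (R := R) hQQ'.le hx (s := s) (a := a)
        (fun hs => hnr ⟨s, hs, s.2⟩) (Subtype.ext (by rw [mul_comm]; exact has))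
    exact PrimeSpectrum.ext (le_antisymm (key _ _ h' (h' ▸ hreg)) (key _ _ h'.symm hreg))

/-- The ring `E = (I : I)` is a finite `R`-module: multiplication by a regular `t ∈ I` embeds it
into the Noetherian module `R`. -/
theorem isIntegral_of_mul_mem_of_regular {I : Ideal R} (hI : IsRegularIdeal I) {y : K}
    (h : ∀ r ∈ I, ∃ a ∈ I, algebraMap R K r * y = algebraMap R K a) : IsIntegral R y := by
  obtain ⟨t, htI, ht⟩ := hI
  have htu : IsUnit (algebraMap R K t) := IsLocalization.map_units K (⟨t, ht⟩ : R⁰)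
  let E : Subalgebra R K :=
    { carrier := {z | ∀ r ∈ I, ∃ a ∈ I, algebraMap R K r * z = algebraMap R K a}
      mul_mem' := by
        intro z w hz hw r hr
        obtain ⟨a, ha, hza⟩ := hz r hr
        obtain ⟨b, hb, hwb⟩ := hw a ha
        exact ⟨b, hb, by rw [← mul_assoc, hza, hwb]⟩
      add_mem' := by
        intro z w hz hw r hr
        obtain ⟨a, ha, hza⟩ := hz r hr
        obtain ⟨b, hb, hwb⟩ := hw r hr
        exact ⟨a + b, I.add_mem ha hb, by rw [mul_add, hza, hwb, map_add]⟩
      algebraMap_mem' := by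
        intro c r hr
        exact ⟨r * c, I.mul_mem_right _ hr, by rw [map_mul]⟩ }
  have hrange : ∀ z : Subalgebra.toSubmodule E,
      LinearMap.mulLeft R (algebraMap R K t) z ∈ LinearMap.range (Algebra.linearMap R K) := by
    intro z
    obtain ⟨a, -, ha⟩ := z.2 t htI
    exact ⟨a, ha.symm⟩
  have : IsNoetherian R (LinearMap.range (Algebra.linearMap R K)) :=
    isNoetherian_of_surjective (Algebra.linearMap R K).rangeRestrict
      (LinearMap.range_rangeRestrict _)
  refine isIntegral_of_submodule_noetherian E (isNoetherian_of_injective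
    (((LinearMap.mulLeft R (algebraMap R K t)).comp
      (Subalgebra.toSubmodule E).subtype).codRestrict _ hrange) ?_) y h
  intro z w hzw
  exact Subtype.ext (htu.mul_left_cancel (congrArg Subtype.val hzw))

/-- If `R` is integrally closed in an overring `C` and every regular prime of `R` is contracted
from `C`, then `C = R`. -/
theorem eq_bot_of_inf_integralClosure_eq_bot (C : Subalgebra R K)
    (hC : ∀ p : Ideal R, p.IsPrime → IsRegularIdeal p →
      ∃ q : Ideal C, q.comap (algebraMap R C) = p)
    (hD : C ⊓ integralClosure R K = ⊥) : C = ⊥ := by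
  rw [eq_bot_iff]
  intro x hx
  by_contra hxR
  let M : Submodule R C := LinearMap.range (Algebra.linearMap R C)
  have hM : ∀ z : C, z ∈ M ↔ ∃ a, algebraMap R K a = z := fun z =>
    ⟨fun ⟨a, ha⟩ => ⟨a, congrArg Subtype.val ha⟩, fun ⟨a, ha⟩ => ⟨a, Subtype.ext ha⟩⟩
  have hx0 : M.mkQ ⟨x, hx⟩ ≠ 0 := by
    rw [Submodule.mkQ_apply, Ne, Submodule.Quotient.mk_eq_zero, hM]
    exact fun h => hxR (Algebra.mem_bot.2 h)
  -- Here `p = (R : y)` is an associated prime of `C/R`; it is regular because it contains a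
  -- denominator of `y`.
  obtain ⟨p, hp, -⟩ := exists_le_isAssociatedPrime_of_isNoetherianRing R _ hx0
  obtain ⟨hpp, y', hy'⟩ := isAssociatedPrime_iff.1 hp
  obtain ⟨y, rfl⟩ := M.mkQ_surjective y'
  have hmem : ∀ r, r ∈ p ↔ ∃ a, algebraMap R K r * y = algebraMap R K a := by
    intro r
    rw [hy', Submodule.mem_colon_singleton, Submodule.mem_bot, ← map_smul, Submodule.mkQ_apply,
      Submodule.Quotient.mk_eq_zero, hM]
    simp [Algebra.smul_def, eq_comm]
  have hreg : IsRegularIdeal p := by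
    obtain ⟨⟨a, s⟩, has⟩ := IsLocalization.surj R⁰ (y : K)
    exact ⟨s, (hmem s).2 ⟨a, by rw [mul_comm]; exact has⟩, s.2⟩
  obtain ⟨q, hq⟩ := hC p hpp hreg
  -- If `q` lies over `p`, then `py ⊆ q ∩ R = p`.
  have hint : IsIntegral R (y : K) := by
    refine isIntegral_of_mul_mem_of_regular hreg fun r hr => ?_
    obtain ⟨a, ha⟩ := (hmem r).1 hr
    refine ⟨a, ?_, ha⟩
    have hrq : algebraMap R C r ∈ q := by rw [← hq] at hr; exact hr
    have : algebraMap R C a = algebraMap R C r * y := Subtype.ext ha.symm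
    rw [← hq, Ideal.mem_comap, this]
    exact q.mul_mem_right _ hrq
  have hybot : (y : K) ∈ (⊥ : Subalgebra R K) := hD ▸ ⟨y.2, hint⟩
  obtain ⟨a, ha⟩ := Algebra.mem_bot.1 hybot
  exact hpp.ne_top ((Ideal.eq_top_iff_one _).2 ((hmem 1).2 ⟨a, by simp [ha]⟩))

end Unibranched

/-! ### A local flatness criterion and integral closedness of Manis DVRs. -/

/-- An injective ring map `A → B` such that `A → B` is locally surjective at every maximal ideal
of `B` is flat. -/
theorem Module.Flat.of_forall_isMaximal_exists_mul_mem {A B : Type*} [CommRing A] [CommRing B]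
    [Algebra A B] (hinj : Function.Injective (algebraMap A B))
    (h : ∀ Q : Ideal B, Q.IsMaximal → ∀ x : B, ∃ s : A, algebraMap A B s ∉ Q ∧
      ∃ a, algebraMap A B s * x = algebraMap A B a) : Module.Flat A B := by
  rw [Module.Flat.iff_lTensor_injective']
  intro I
  rw [injective_iff_map_eq_zero]
  intro z hz
  -- Locally at `Q` every tensor is of the form `1 ⊗ i`; for `z` in the kernel this forces `i = 0`,
  -- so no maximal ideal contains the annihilator of `z`.
  have key : ∀ Q : Ideal B, Q.IsMaximal → ∀ z : TensorProduct A B I,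
      ∃ s : A, algebraMap A B s ∉ Q ∧ ∃ i : I, s • z = (1 : B) ⊗ₜ[A] i := by
    intro Q hQ z
    have hQp : Q.IsPrime := hQ.isPrime
    induction z with
    | zero => exact ⟨1, by simpa using hQp.one_notMem, 0, by simp⟩
    | tmul x i =>
      obtain ⟨s, hs, a, hsa⟩ := h Q hQ x
      refine ⟨s, hs, a • i, ?_⟩
      rw [TensorProduct.smul_tmul', Algebra.smul_def, hsa, Algebra.algebraMap_eq_smul_one,
        TensorProduct.smul_tmul]
    | add z w hz hw =>
      obtain ⟨s, hs, i, hi⟩ := hz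
      obtain ⟨t, ht, j, hj⟩ := hw
      refine ⟨s * t, ?_, t • i + s • j, ?_⟩
      · rw [map_mul]
        exact fun hm => (hQp.mem_or_mem hm).elim hs ht
      · rw [smul_add, mul_comm s t, mul_smul, hi, mul_comm t s, mul_smul, hj,
          TensorProduct.tmul_add, TensorProduct.tmul_smul, TensorProduct.tmul_smul]
  by_contra hz0
  let J : Ideal B := LinearMap.ker (LinearMap.toSpanSingleton B _ z)
  have hJ : J ≠ ⊤ := by
    rw [Ne, Ideal.eq_top_iff_one]
    intro h1
    exact hz0 (by simpa [J] using h1)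
  obtain ⟨Q, hQ, hJQ⟩ := Ideal.exists_le_maximal J hJ
  obtain ⟨s, hs, i, hi⟩ := key Q hQ z
  have hi0 : (1 : B) ⊗ₜ[A] (i : A) = 0 := by
    have := congrArg (LinearMap.lTensor B I.subtype) hi
    rw [map_smul, hz, smul_zero] at this
    simpa using this.symm
  have hi0' : i = 0 := by
    have := congrArg (TensorProduct.rid A B) hi0
    rw [TensorProduct.rid_tmul, map_zero, ← Algebra.algebraMap_eq_smul_one] at this
    exact Subtype.ext (hinj (by rw [this]; simp))
  apply hs
  apply hJQ
  change LinearMap.toSpanSingleton B _ z (algebraMap A B s) = 0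
  rw [LinearMap.toSpanSingleton_apply, algebraMap_smul, hi, hi0', TensorProduct.tmul_zero]

theorem IsManisDVR.integralClosure_le {A K : Type*} [CommRing A] [CommRing K]
    [Algebra A K] {V : Subalgebra A K} (hV : IsManisDVR V.toSubring) :
    integralClosure A K ≤ V := by
  obtain ⟨v, -, hv⟩ := hV
  intro x hx
  have hx' : IsIntegral V x := IsIntegral.tower_top (A := V) hx
  change x ∈ V.toSubring
  rw [← hv]
  refine Valuation.Integers.mem_of_integral (O := V) (v := v) ⟨Subtype.val_injective, ?_, ?_⟩ hx'
  · intro y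
    have : (y : K) ∈ V.toSubring := y.2
    rw [← hv] at this
    exact this
  · intro y hy
    have : y ∈ V.toSubring := by rw [← hv]; exact hy
    exact ⟨⟨y, this⟩, rfl⟩

/-! ### Passage to `A_(P)`: transfer of going down and of the DVR hypothesis. -/

section RegularQuotient

variable {A K : Type*} [CommRing A] [CommRing K] [Algebra A K] [IsFractionRing A K]
  (P : Ideal A) [P.IsPrime]

instance regularQuotient.isLocalization :
    IsLocalization (P.primeCompl ⊓ A⁰) (regularQuotient K P) :=
  Localization.subalgebra.isLocalization_subalgebra K _ inf_le_right

instance regularQuotient.isFractionRing : IsFractionRing (regularQuotient K P) K :=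
  Localization.subalgebra.isFractionRing K _ inf_le_right

instance regularQuotient.isNoetherianRing [IsNoetherianRing A] :
    IsNoetherianRing (regularQuotient K P) :=
  IsLocalization.isNoetherianRing (P.primeCompl ⊓ A⁰) _ ‹_›

theorem exists_mul_eq_of_mem_regularQuotient {x : K} (hx : x ∈ regularQuotient K P) :
    ∃ s ∈ P.primeCompl ⊓ A⁰, ∃ a, algebraMap A K s * x = algebraMap A K a := by
  obtain ⟨⟨a, s⟩, has⟩ := IsLocalization.surj (P.primeCompl ⊓ A⁰) (⟨x, hx⟩ : regularQuotient K P)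
  exact ⟨s, s.2, a, by rw [mul_comm]; exact congrArg Subtype.val has⟩

/-- The localization of an overring `B` of `A` at the regular elements of `A` outside `P`, as an
overring of `A_(P)`. -/
noncomputable def regularQuotientOverring (B : Subalgebra A K) :
    Subalgebra (regularQuotient K P) K where
  carrier := {x | ∃ s ∈ P.primeCompl ⊓ A⁰, algebraMap A K s * x ∈ B}
  mul_mem' := by
    rintro x y ⟨s, hs, hsx⟩ ⟨t, ht, hty⟩
    refine ⟨s * t, mul_mem hs ht, ?_⟩
    rw [map_mul, mul_mul_mul_comm]
    exact mul_mem hsx hty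
  add_mem' := by
    rintro x y ⟨s, hs, hsx⟩ ⟨t, ht, hty⟩
    refine ⟨s * t, mul_mem hs ht, ?_⟩
    rw [map_mul, mul_add, mul_right_comm, mul_assoc _ _ y]
    exact add_mem (mul_mem hsx (B.algebraMap_mem t)) (mul_mem (B.algebraMap_mem s) hty)
  algebraMap_mem' := by
    intro r
    obtain ⟨s, hs, a, hsa⟩ := exists_mul_eq_of_mem_regularQuotient P r.2
    exact ⟨s, hs, by
      rw [show algebraMap (regularQuotient K P) K r = r from rfl, hsa]
      exact B.algebraMap_mem a⟩

theorem isUnit_algebraMap_regularQuotient {s : A} (hs : s ∈ P.primeCompl ⊓ A⁰) :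
    IsUnit (algebraMap A (regularQuotient K P) s) :=
  IsLocalization.map_units _ (⟨s, hs⟩ : ↥(P.primeCompl ⊓ A⁰))

theorem le_of_comap_regularQuotient_le {I J : Ideal (regularQuotient K P)}
    (h : I.comap (algebraMap A _) ≤ J.comap (algebraMap A _)) : I ≤ J := by
  refine RingHom.le_of_comap_le_of_localization (algebraMap A (regularQuotient K P))
    (P.primeCompl ⊓ A⁰) (fun s hs => isUnit_algebraMap_regularQuotient P hs) (fun x => ?_) h
  obtain ⟨s, hs, a, hsa⟩ := exists_mul_eq_of_mem_regularQuotient P x.2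
  exact ⟨s, hs, a, Subtype.ext hsa⟩

theorem disjoint_comap_regularQuotient {p : Ideal (regularQuotient K P)} (hp : p ≠ ⊤) :
    Disjoint ((P.primeCompl ⊓ A⁰ : Submonoid A) : Set A) (p.comap (algebraMap A _)) :=
  Set.disjoint_left.2 fun _ hs hsp =>
    hp (p.eq_top_of_isUnit_mem hsp (isUnit_algebraMap_regularQuotient P hs))

theorem comap_regularQuotient_le [IsNoetherianRing A] {p : Ideal (regularQuotient K P)}
    (hp : p ≠ ⊤) (hreg : IsRegularIdeal p) : p.comap (algebraMap A _) ≤ P := by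
  by_contra h
  obtain ⟨x, hx, hx0, hxP⟩ :=
    (IsRegularIdeal.comap_algebraMap (regularQuotient K P) hreg).exists_regular_notMem h
  exact Set.disjoint_left.1 (disjoint_comap_regularQuotient P hp) ⟨hxP, hx0⟩ hx

variable {P}

theorem exists_generalizing_prime_regularQuotientOverring [IsNoetherianRing A]
    (B : Subalgebra A K) [Algebra.HasGoingDown A B] (Q : Ideal B) [Q.IsPrime] [Q.LiesOver P]
    (p : Ideal (regularQuotient K P)) (hp : p.IsPrime) (hreg : IsRegularIdeal p) :
    ∃ q : Ideal (regularQuotientOverring P B), q.IsPrime ∧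
      q.comap (algebraMap (regularQuotient K P) _) = p ∧
      ∀ p₀ : Ideal (regularQuotient K P), p₀.IsPrime → IsRegularIdeal p₀ → p₀ ≤ p →
        ∃ q₀ ≤ q, q₀.IsPrime ∧ q₀.comap (algebraMap (regularQuotient K P) _) = p₀ := by
  let f : B →+* regularQuotientOverring P B :=
    (algebraMap B K).codRestrict (regularQuotientOverring P B) fun x => ⟨1, one_mem _, by simp⟩
  have hinj : Function.Injective f := fun x y h =>
    Subtype.ext (show (f x : K) = f y by rw [h])
  have hcomp : f.comp (algebraMap A B) =
      (algebraMap (regularQuotient K P) (regularQuotientOverring P B)).comp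
        (algebraMap A (regularQuotient K P)) := rfl
  let S : Submonoid B := (P.primeCompl ⊓ A⁰).map (algebraMap A B)
  have hu : ∀ s ∈ S, IsUnit (f s) := by
    rintro _ ⟨s, hs, rfl⟩
    exact (isUnit_algebraMap_regularQuotient (K := K) P hs).map
      (algebraMap (regularQuotient K P) (regularQuotientOverring P B))
  have hs : ∀ x : regularQuotientOverring P B, ∃ s ∈ S, ∃ t, f s * x = f t := by
    rintro ⟨x, s, hs, hsx⟩
    exact ⟨_, ⟨s, hs, rfl⟩, ⟨_, hsx⟩, Subtype.ext rfl⟩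
  have lift : ∀ p : Ideal (regularQuotient K P), p ≠ ⊤ → ∀ q : Ideal B, q.IsPrime →
      q.comap (algebraMap A B) = p.comap (algebraMap A (regularQuotient K P)) →
      ∃ q' : Ideal (regularQuotientOverring P B), q'.IsPrime ∧ q'.comap f = q ∧
        q'.comap (algebraMap (regularQuotient K P) (regularQuotientOverring P B)) = p := by
    intro p hp q hq hqp
    have hdis : Disjoint (S : Set B) q := by
      rw [Set.disjoint_left]
      rintro _ ⟨s, hs, rfl⟩ hsq
      refine Set.disjoint_left.1 (disjoint_comap_regularQuotient P hp) hs ?_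
      rw [SetLike.mem_coe, ← hqp]
      exact hsq
    obtain ⟨q', hq', hq'q⟩ :=
      RingHom.exists_prime_comap_eq_of_localization f S hinj hu hs q hq hdis
    have heq : (q'.comap (algebraMap (regularQuotient K P) (regularQuotientOverring P B))).comap
        (algebraMap A (regularQuotient K P)) = p.comap (algebraMap A (regularQuotient K P)) := by
      rw [Ideal.comap_comap, ← hcomp, ← Ideal.comap_comap, hq'q, hqp]
    exact ⟨q', hq', hq'q, le_antisymm (le_of_comap_regularQuotient_le P heq.le)
      (le_of_comap_regularQuotient_le P heq.ge)⟩
  -- Going down is used twice: from `Q` to a prime over `p`, then from that prime to one over `p₀`.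
  obtain ⟨qB, -, hqB, hqBp⟩ := Ideal.exists_ideal_le_liesOver_of_le
    (p := p.comap (algebraMap A (regularQuotient K P))) (q := P) Q
    (comap_regularQuotient_le P hp.ne_top hreg)
  obtain ⟨q, hq, hqqB, hqp⟩ := lift p hp.ne_top qB hqB hqBp.over.symm
  refine ⟨q, hq, hqp, fun p₀ hp₀ _ hle => ?_⟩
  obtain ⟨q₀B, hq₀le, hq₀B, hq₀Bp⟩ := Ideal.exists_ideal_le_liesOver_of_le
    (p := p₀.comap (algebraMap A (regularQuotient K P)))
    (q := p.comap (algebraMap A (regularQuotient K P))) qB (Ideal.comap_mono hle)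
  obtain ⟨q₀, hq₀, hq₀q, hq₀p⟩ := lift p₀ hp₀.ne_top q₀B hq₀B hq₀Bp.over.symm
  exact ⟨q₀, RingHom.le_of_comap_le_of_localization f S hu hs (by rwa [hq₀q, hqqB]), hq₀, hq₀p⟩

/-- `N` contracts to a minimal regular prime of the integral closure `A'` of `A`. The attached DVR
is integrally closed in `K`, so it contains `A'`, which supplies denominators outside `N`. -/
theorem exists_mul_mem_of_isMinimalRegularPrime
    (hA : ∀ (P : Ideal (integralClosure A K)) [P.IsPrime], IsMinimalRegularPrime P →
      IsManisDVR (regularQuotient K (P.comap (algebraMap A (integralClosure A K)))).toSubring)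
    (N : Ideal (integralClosure (regularQuotient K P) K)) (hN : N.IsPrime)
    (hmin : IsMinimalRegularPrime N) (x : K) (hx : x ∈ integralClosure (regularQuotient K P) K) :
    ∃ s, s ∉ N.comap (algebraMap (regularQuotient K P) _) ∧
      ∃ a, algebraMap (regularQuotient K P) K s * x = algebraMap (regularQuotient K P) K a := by
  let f : integralClosure A K →+* integralClosure (regularQuotient K P) K :=
    (algebraMap (integralClosure A K) K).codRestrict (integralClosure (regularQuotient K P) K)
      fun x => IsIntegral.tower_top (A := (regularQuotient K P)) x.2
  have hinj : Function.Injective f := fun x y h =>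
    Subtype.ext (show (f x : K) = f y by rw [h])
  have hcomp : f.comp (algebraMap A (integralClosure A K)) =
    (algebraMap (regularQuotient K P) (integralClosure (regularQuotient K P) K)).comp
      (algebraMap A (regularQuotient K P)) := rfl
  let S : Submonoid (integralClosure A K) := (P.primeCompl ⊓ A⁰).map (algebraMap A _)
  have hu : ∀ s ∈ S, IsUnit (f s) := by
    rintro _ ⟨s, hs, rfl⟩
    exact (isUnit_algebraMap_regularQuotient (K := K) P hs).map
      (algebraMap (regularQuotient K P) (integralClosure (regularQuotient K P) K))
  have hs : ∀ x : integralClosure (regularQuotient K P) K, ∃ s ∈ S, ∃ t, f s * x = f t := by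
    rintro ⟨x, hx⟩
    obtain ⟨s, hsx⟩ :=
      IsIntegral.exists_multiple_integral_of_isLocalization (P.primeCompl ⊓ A⁰) x hx
    rw [Submonoid.smul_def, Algebra.smul_def] at hsx
    exact ⟨_, ⟨s, s.2, rfl⟩, ⟨_, hsx⟩, Subtype.ext rfl⟩
  have hNR : IsRegularIdeal
      (N.comap (algebraMap (regularQuotient K P) (integralClosure (regularQuotient K P) K))) :=
    hmin.1.2.comap_algebraMap _
  have hNA : IsRegularIdeal ((N.comap f).comap (algebraMap A (integralClosure A K))) := by
    rw [Ideal.comap_comap, hcomp, ← Ideal.comap_comap]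
    exact IsRegularIdeal.comap_algebraMap (regularQuotient K P) hNR
  have hmin' : IsMinimalRegularPrime (N.comap f) := by
    refine ⟨⟨inferInstance, hNA.of_comap_algebraMap⟩, ?_⟩
    rintro N₀ ⟨hN₀, hN₀reg⟩ hle
    have hdis : Disjoint (S : Set (integralClosure A K)) N₀ := Set.disjoint_left.2 fun s hs hsN =>
      hN.ne_top (N.eq_top_of_isUnit_mem (hle hsN) (hu s hs))
    obtain ⟨N₁, hN₁, hN₁N₀⟩ :=
      RingHom.exists_prime_comap_eq_of_localization f S hinj hu hs N₀ hN₀ hdis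
    have hN₁reg : IsRegularIdeal N₁ := by
      obtain ⟨c, hc, hc0⟩ := hN₀reg
      rw [← hN₁N₀] at hc
      exact ⟨f c, hc, mem_nonZeroDivisors_of_isUnit_coe _
        (isUnit_coe_of_mem_nonZeroDivisors (integralClosure A K) hc0)⟩
    have hN₁N : N₁ ≤ N :=
      RingHom.le_of_comap_le_of_localization f S hu hs (by rwa [hN₁N₀])
    rw [← hN₁N₀]
    exact Ideal.comap_mono (hmin.2 ⟨hN₁, hN₁reg⟩ hN₁N)
  have hV := (hA _ hmin').integralClosure_le
  obtain ⟨_, ⟨s, hsS, rfl⟩, t, hst⟩ := hs ⟨x, hx⟩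
  obtain ⟨u, hu', a, hua⟩ := exists_mul_eq_of_mem_regularQuotient _ (hV t.2)
  refine ⟨algebraMap A (regularQuotient K P) (u * s), ?_, algebraMap A (regularQuotient K P) a, ?_⟩
  · intro hmem
    rw [map_mul] at hmem
    rcases Ideal.IsPrime.mem_or_mem
      (inferInstance : (N.comap (algebraMap (regularQuotient K P) _)).IsPrime) hmem with h | h
    · exact hu'.1 h
    · exact hN.ne_top (N.eq_top_of_isUnit_mem h (hu _ ⟨s, hsS, rfl⟩))
  · have hst' : algebraMap A K s * x = t := congrArg Subtype.val hst
    change algebraMap A K (u * s) * x = algebraMap A K a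
    rw [map_mul, mul_assoc, hst', hua]

end RegularQuotient

/-! ### Going down for unibranched extensions, faithfully flat overrings, and the equivalence. -/

/-- An integral unibranched extension satisfies going down. -/
theorem IsUnibranched.hasGoingDown {R S : Type*} [CommRing R] [CommRing S] [Algebra R S]
    [Algebra.IsIntegral R S] (h : IsUnibranched R S) : Algebra.HasGoingDown R S where
  exists_ideal_le_liesOver_of_lt {p} hp Q hQ hlt := by
    obtain ⟨⟨Q₀, hQ₀⟩, hQ₀p⟩ := h.2 ⟨p, hp⟩
    have hQ₀p' : Q₀.comap (algebraMap R S) = p := congrArg PrimeSpectrum.asIdeal hQ₀p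
    -- Going up from the prime over `p` reaches a prime over `Q ∩ R`, which is `Q` by uniqueness.
    obtain ⟨Q₁, hle, hQ₁, hQ₁Q⟩ := Ideal.exists_ideal_over_prime_of_isIntegral_of_isPrime
      (Q.under R) Q₀ (hQ₀p'.le.trans hlt.le)
    have : (⟨Q₁, hQ₁⟩ : PrimeSpectrum S) = ⟨Q, hQ⟩ := h.1 (PrimeSpectrum.ext hQ₁Q)
    have hQQ : Q₁ = Q := congrArg PrimeSpectrum.asIdeal this
    exact ⟨Q₀, hQQ ▸ hle, hQ₀, ⟨hQ₀p'.symm⟩⟩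

/-- A faithfully flat overring is trivial. -/
theorem Subalgebra.eq_bot_of_faithfullyFlat {R K : Type*} [CommRing R] [CommRing K] [Algebra R K]
    [IsFractionRing R K] (B : Subalgebra R K) [Module.FaithfullyFlat R B] : B = ⊥ := by
  rw [eq_bot_iff]
  intro x hx
  obtain ⟨⟨a, s⟩, has⟩ := IsLocalization.surj R⁰ x
  -- With `x = a/s`, `a ∈ sB ∩ R = sR` by faithful flatness.
  have hmem : a ∈ ((Ideal.span {(s : R)}).map (algebraMap R B)).comap (algebraMap R B) := by
    rw [Ideal.mem_comap, Ideal.map_span, Set.image_singleton, Ideal.mem_span_singleton]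
    exact ⟨⟨x, hx⟩, Subtype.ext (has.symm.trans (mul_comm _ _))⟩
  rw [Ideal.comap_map_eq_self_of_faithfullyFlat, Ideal.mem_span_singleton] at hmem
  obtain ⟨r, rfl⟩ := hmem
  refine Algebra.mem_bot.2 ⟨r, ?_⟩
  have hs : IsUnit (algebraMap R K s) := IsLocalization.map_units K s
  rw [map_mul, mul_comm] at has
  exact (hs.mul_left_cancel has).symm

/-- Overrings of `A_(P)` are the `A_(P)`-subalgebras `B` of `K`; `B = ⊥` says `B = A_(P)`. -/
theorem theorem28 {A K : Type*} [CommRing A] [IsNoetherianRing A] [CommRing K] [Algebra A K]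
    [IsFractionRing A K]
    (hA : ∀ (P : Ideal (integralClosure A K)) [P.IsPrime], IsMinimalRegularPrime P →
      IsManisDVR (regularQuotient K (P.comap (algebraMap A (integralClosure A K)))).toSubring) :
    IsPerinormal A K ↔
      ∀ (P : Ideal A) [P.IsPrime] (B : Subalgebra (regularQuotient K P) K),
        Algebra.IsIntegral (regularQuotient K P) B → IsUnibranched (regularQuotient K P) B →
          B = ⊥ := by
  constructor
  · intro hper P _ B hint huni
    have hgd : Algebra.HasGoingDown (regularQuotient K P) B := huni.hasGoingDown
    have hflat : Module.Flat A (regularQuotient K P) :=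
      IsLocalization.flat _ (P.primeCompl ⊓ A⁰)
    have hgdA : Algebra.HasGoingDown A (B.restrictScalars A) :=
      Algebra.HasGoingDown.trans (R := A) (S := regularQuotient K P) (T := B)
    have hflatB : Module.Flat A B := hper _ hgdA
    have : Module.Flat (regularQuotient K P) B :=
      (Module.flat_iff_of_isLocalization (regularQuotient K P) (P.primeCompl ⊓ A⁰) B).2 hflatB
    have : Module.FaithfullyFlat (regularQuotient K P) B :=
      Module.FaithfullyFlat.of_comap_surjective huni.2
    exact B.eq_bot_of_faithfullyFlat
  · intro h B hgd
    refine Module.Flat.of_forall_isMaximal_exists_mul_mem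
      (fun x y hxy => IsFractionRing.injective A K (congrArg Subtype.val hxy)) ?_
    intro Q hQ x
    have hQp : Q.IsPrime := hQ.isPrime
    let P : Ideal A := Q.under A
    have hC := exists_generalizing_prime_regularQuotientOverring (P := P) B Q
    obtain ⟨hint, huni⟩ := isUnibranched_inf_integralClosure (regularQuotientOverring P B) hC
      (exists_mul_mem_of_isMinimalRegularPrime hA)
    have hbot := eq_bot_of_inf_integralClosure_eq_bot (regularQuotientOverring P B)
      (fun p hp hreg => (hC p hp hreg).imp fun _ hq => hq.2.1) (h P _ hint huni)
    have hx : (x : K) ∈ regularQuotientOverring P B := ⟨1, one_mem _, by simp⟩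
    rw [hbot] at hx
    obtain ⟨r, hr⟩ := Algebra.mem_bot.1 hx
    have hxR : (x : K) ∈ regularQuotient K P := hr ▸ r.2
    obtain ⟨s, hs, a, hsa⟩ := exists_mul_eq_of_mem_regularQuotient P hxR
    exact ⟨s, hs.1, a, Subtype.ext hsa⟩
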